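/- Let $\ell\ge 1$, let $G_1,\dots,G_\ell$ be finite digraphs (not necessarily disjoint; loops and parallel edges are allowed), let $S_i\subseteq V(G_i)$ for $i\in[\ell]$, and let $B\subseteq\bigcup_{i=1}^{\ell}V(G_i)$. A path consists of pairwise distinct vertices $v_1,\dots,v_k$, $k\ge 1$, and the edges $(v_j,v_{j+1})$; it starts at $v_1$ and ends at its last vertex $v_k$. A set $\mathscr P$ of paths is a set of D-paths with respect to $B$ if the paths in $\mathscr P$ end in pairwise distinct vertices, all of them in $B$, and $\mathscr P$ can be partitioned into (possibly empty) parts $\mathcal P_1,\dots,\mathcal P_\ell$ such that, for each $i\in[\ell]$, the elements of $\mathcal P_i$ are pairwise vertex-disjoint paths in $G_i$ that start in $S_i$. For a finite digraph $G$ and $X,Y\subseteq V(G)$, the gammoid $M(G,X,Y)$ is the matroid on $Y$ whose independent sets are the sets of last vertices of collections of pairwise vertex-disjoint paths in $G$ that start in $X$ and end in $Y$. Proposition. The gammoids $M_i=M(G_i,S_i,B\cap V(G_i))$, $i\in[\ell]$, are matroids; let $r_i$ be the rank function of $M_i$. The sets of last vertices of sets of D-paths with respect to $B$ are exactly the independent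 sets of a matroid on $B$ (the D-paths matroid), and the rank function $r$ of this matroid satisfies $$r(U)=\min_{T\subseteq U}\Bigl(|U\setminus T|+\sum_{i=1}^{\ell} r_i\bigl(T\cap V(G_i)\bigr)\Bigr)\qquad\text{for all } U\subseteq B.$$ -/

import Mathlib

/-- A digraph with vertices taken from `α` and edges taken from `β`.
Loops and parallel edges are allowed. -/
structure MultiDigraph (α : Type*) (β : Type*) where
  /-- the vertex set `V(G)` -/
  verts : Set α
  /-- the edge set `E(G)` -/
  edges : Set β
  /-- the tail of an edge -/
  tail : β → α
  /-- the head of an edge -/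
  head : β → α
  tail_mem : ∀ e ∈ edges, tail e ∈ verts
  head_mem : ∀ e ∈ edges, head e ∈ verts

/-- There is an edge of `G` oriented from `u` to `v`. -/
def MultiDigraph.HasEdge {α β : Type*} (G : MultiDigraph α β) (u v : α) : Prop :=
  ∃ e ∈ G.edges, G.tail e = u ∧ G.head e = v

/-- A directed path: the digraph with pairwise distinct vertices `v₁, …, vₖ`, `k ≥ 1`, and with
edges `(vⱼ, vⱼ₊₁)`. It is determined by the list `[v₁, …, vₖ]`; one-vertex paths are allowed. -/
@[ext]
structure DiPath (α : Type*) where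
  /-- the vertices, in the order of the path -/
  support : List α
  ne_nil : support ≠ []
  nodup : support.Nodup

namespace DiPath

variable {α β : Type*}

/-- The first vertex of a path. -/
def source (P : DiPath α) : α := P.support.head P.ne_nil

/-- The last vertex of a path. -/
def sink (P : DiPath α) : α := P.support.getLast P.ne_nil

/-- `P` is a path in the digraph `G`. -/
def IsIn (P : DiPath α) (G : MultiDigraph α β) : Prop :=
  (∀ v ∈ P.support, v ∈ G.verts) ∧ P.support.IsChain G.HasEdge

/-- The paths in the collection `Ps` are pairwise vertex-disjoint. -/
def PairwiseDisjoint (Ps : Set (DiPath α)) : Prop :=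
  ∀ P ∈ Ps, ∀ Q ∈ Ps, P ≠ Q → ∀ v ∈ P.support, v ∉ Q.support

end DiPath

/-- `Ps` is a collection of disjoint `X → Y` paths in `G`. -/
def IsDisjointPaths {α β : Type*} (G : MultiDigraph α β) (X Y : Set α)
    (Ps : Set (DiPath α)) : Prop :=
  (∀ P ∈ Ps, P.IsIn G ∧ P.source ∈ X ∧ P.sink ∈ Y) ∧ DiPath.PairwiseDisjoint Ps

/-- `M` is the gammoid `M(G, X, Y)`: the matroid on `Y` whose independent sets are the sets of
last vertices of collections of disjoint `X → Y` paths in `G`. -/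
def IsGammoid {α β : Type*} (M : Matroid α) (G : MultiDigraph α β) (X Y : Set α) : Prop :=
  M.E = Y ∧
    ∀ I : Set α, M.Indep I ↔ ∃ Ps : Set (DiPath α), IsDisjointPaths G X Y Ps ∧ I = DiPath.sink '' Ps

/-- There is only one matroid that is the gammoid `M(G, X, Y)`. -/
theorem IsGammoid.unique {α β : Type*} {M N : Matroid α} {G : MultiDigraph α β} {X Y : Set α}
    (hM : IsGammoid M G X Y) (hN : IsGammoid N G X Y) : M = N :=
  Matroid.ext_indep (hM.1.trans hN.1.symm) fun I _ => (hM.2 I).trans (hN.2 I).symm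

/-- `part` is a defining partition of `Ps` (parts may be empty): it shows that the set of paths
`Ps` respects the sequence of digraphs `G` and the sequence of source sets `S`. -/
def IsDefiningPartition {α β : Type*} {ℓ : ℕ} (G : Fin ℓ → MultiDigraph α β)
    (S : Fin ℓ → Set α) (Ps : Set (DiPath α)) (part : Fin ℓ → Set (DiPath α)) : Prop :=
  (⋃ i, part i) = Ps ∧
  (∀ i j, i ≠ j → Disjoint (part i) (part j)) ∧
  (∀ i, (∀ P ∈ part i, P.IsIn (G i)) ∧ DiPath.PairwiseDisjoint (part i)) ∧
  (∀ i, ∀ P ∈ part i, P.source ∈ S i)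

/-- `Ps` is a set of D-paths with respect to `B`. -/
def IsDPaths {α β : Type*} {ℓ : ℕ} (G : Fin ℓ → MultiDigraph α β) (S : Fin ℓ → Set α)
    (B : Set α) (Ps : Set (DiPath α)) : Prop :=
  (∃ part : Fin ℓ → Set (DiPath α), IsDefiningPartition G S Ps part) ∧
  (∀ P ∈ Ps, ∀ Q ∈ Ps, P ≠ Q → P.sink ≠ Q.sink) ∧
  (∀ P ∈ Ps, P.sink ∈ B)

/-! Grouping sinks by part turns a set of D-paths into a colouring of its sinks whose i-th class is
independent in the gammoid `M i`, and conversely (`exists_isDPaths_iff`). So the D-paths matroid is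
the union of the gammoids, and the claimed formula is the rank formula for matroid union. The union
is induced by the submodular function J ↦ ∑ rᵢ(J); the min-max is proved for all such functions
(`isLeast_eRk_ofSubmodular`), and a Rado-type argument recovers the colouring. A linkage is encoded
by an injective predecessor map on V \ X: a set is linked iff it avoids the image of such a map
(`exists_isDisjointPaths_iff`). Such images lie among the bases of a transversal matroid, and every
base contains one, so gammoids are restrictions of its dual. -/

/-! ### Matroids induced by submodular functions -/

namespace Finset

variable {α : Type*} [DecidableEq α]

/-- If `I` is a subset of `U` with `#J ≤ f J` for all `J ⊆ I`, where `f` is monotone and submodular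
with `f ∅ = 0`, and if `I` is maximal with this property, then some `T ⊆ U` bounds the size of all
such subsets of `U` by `#I`. -/
theorem exists_card_sdiff_add_le_card_of_maximal {f : Finset α → ℕ} (h0 : f ∅ = 0)
    (hmono : Monotone f) (hsub : ∀ X Y, f (X ∩ Y) + f (X ∪ Y) ≤ f X + f Y)
    {I U : Finset α} (hIU : I ⊆ U) (hI : ∀ J ⊆ I, #J ≤ f J)
    (hmax : ∀ x ∈ U, x ∉ I → ∃ J ⊆ insert x I, f J < #J) :
    ∃ T ⊆ U, #(U \ T) + f T ≤ #I := by
  -- These are the tight sets, since `#(T ∩ I) ≤ f T` always holds. They are closed under union, and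
  -- each violating `K` is tight, so a maximal tight set contains all of `U \ I`.
  let F : Finset (Finset α) := {T ∈ U.powerset | f T ≤ #(T ∩ I)}
  have hF : ∀ T, T ∈ F ↔ T ⊆ U ∧ f T ≤ #(T ∩ I) := fun T => by simp [F]
  obtain ⟨T, hT⟩ := F.exists_maximal ⟨∅, by simp [hF, h0]⟩
  have hTF := (hF T).1 hT.prop
  have hcover : ∀ x ∈ U, x ∉ I → x ∈ T := by
    intro x hxU hxI
    obtain ⟨K, hK, hlt⟩ := hmax x hxU hxI
    have hxK : x ∈ K := by
      by_contra hxK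
      exact absurd (hI K ((subset_insert_iff_of_notMem hxK).1 hK)) (by omega)
    have hKI : K ∩ I = K.erase x := by
      ext y
      have := @hK y
      grind
    have hKF : f K ≤ #(K ∩ I) := by
      rw [hKI, card_erase_of_mem hxK]
      omega
    have hKU : K ⊆ U := hK.trans (insert_subset hxU hIU)
    have hunion : T ∪ K ∈ F := by
      refine (hF _).2 ⟨union_subset hTF.1 hKU, ?_⟩
      have h1 := hsub T K
      have h2 := hI (T ∩ K ∩ I) inter_subset_right
      have h3 := hmono (inter_subset_left : T ∩ K ∩ I ⊆ T ∩ K)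
      have h4 := card_union_add_card_inter (T ∩ I) (K ∩ I)
      rw [← union_inter_distrib_right, ← inter_inter_distrib_right] at h4
      have := hTF.2
      omega
    exact hT.le_of_ge hunion subset_union_left (mem_union_right _ hxK)
  refine ⟨T, hTF.1, ?_⟩
  have h1 : U \ T = I \ T := by
    ext y
    have := hcover y
    have := @hIU y
    grind
  have h2 := card_sdiff_add_card_inter I T
  rw [h1, ← h2, inter_comm I T]
  exact Nat.add_le_add_left hTF.2 _

/-- The easy half of the min-max: `I \ T` lies in `U \ T`, and `f` bounds `I ∩ T`. -/
theorem card_le_card_sdiff_add {f : Finset α → ℕ} (hmono : Monotone f)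
    {I U : Finset α} (hIU : I ⊆ U) (hI : ∀ J ⊆ I, #J ≤ f J) (T : Finset α) :
    #I ≤ #(U \ T) + f T := by
  have h1 := card_sdiff_add_card_inter I T
  have h2 := hI (I ∩ T) inter_subset_left
  have h3 := hmono (inter_subset_right : I ∩ T ⊆ T)
  have h4 := card_le_card (sdiff_subset_sdiff hIU (Subset.refl T))
  omega

end Finset

namespace Matroid

open Finset

variable {α : Type*} [DecidableEq α]

/-- The matroid on `E` induced by a monotone submodular function `f` with `f ∅ = 0`: a finite set
`I ⊆ E` is independent iff `#J ≤ f J` for all `J ⊆ I`. -/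
def ofSubmodular (E : Finset α) (f : Finset α → ℕ) (h0 : f ∅ = 0)
    (hmono : Monotone f) (hsub : ∀ X Y, f (X ∩ Y) + f (X ∪ Y) ≤ f X + f Y) : Matroid α :=
  (IndepMatroid.ofFinset (E : Set α) (fun I => I ⊆ E ∧ ∀ J ⊆ I, #J ≤ f J)
    (by simp)
    (fun _ _ hJ hIJ => ⟨hIJ.trans hJ.1, fun K hK => hJ.2 K (hK.trans hIJ)⟩)
    (by
      intro I J hI hJ hlt
      by_contra! hcon
      -- If no element of `J` augments `I`, then `I` is maximal in `I ∪ J`, and the resulting bound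
      -- also applies to `J`.
      obtain ⟨T, -, hT⟩ := exists_card_sdiff_add_le_card_of_maximal h0 hmono hsub
        (subset_union_left : I ⊆ I ∪ J) hI.2 (by
          intro x hx hxI
          have hxJ : x ∈ J := by grind
          exact hcon x hxJ hxI (Finset.insert_subset (hJ.1 hxJ) hI.1))
      have := card_le_card_sdiff_add hmono (subset_union_right : J ⊆ I ∪ J) hJ.2 T
      omega)
    (fun _ hI => by exact_mod_cast hI.1)).matroid

variable {E : Finset α} {f : Finset α → ℕ} {h0 : f ∅ = 0} {hmono : Monotone f}
  {hsub : ∀ X Y, f (X ∩ Y) + f (X ∪ Y) ≤ f X + f Y}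

@[simp] theorem ofSubmodular_ground : (ofSubmodular E f h0 hmono hsub).E = E := rfl

theorem ofSubmodular_indep_iff {I : Finset α} :
    (ofSubmodular E f h0 hmono hsub).Indep I ↔ I ⊆ E ∧ ∀ J ⊆ I, #J ≤ f J := by
  simp only [ofSubmodular, IndepMatroid.matroid_Indep]
  exact IndepMatroid.ofFinset_indep _ _ _ _ _ _

theorem isLeast_eRk_ofSubmodular {U : Finset α} (hU : U ⊆ E) :
    IsLeast {r : ℕ∞ | ∃ T ⊆ U, r = (#(U \ T) + f T : ℕ)}
      ((ofSubmodular E f h0 hmono hsub).eRk U) := by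
  obtain ⟨I', hI'⟩ := (ofSubmodular E f h0 hmono hsub).exists_isBasis (U : Set α)
    (by simpa using hU)
  obtain ⟨I, rfl⟩ := (U.finite_toSet.subset hI'.subset).exists_finset_coe
  have hIU : I ⊆ U := by exact_mod_cast hI'.subset
  have hI := ofSubmodular_indep_iff.1 hI'.indep
  have hle := card_le_card_sdiff_add hmono hIU hI.2
  rw [hI'.eRk_eq_encard, Set.encard_coe_eq_coe_finsetCard]
  constructor
  · obtain ⟨T, hT, hcard⟩ := exists_card_sdiff_add_le_card_of_maximal h0 hmono hsub hIU hI.2 (by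
      intro x hx hxI
      by_contra! h
      refine hxI (hI'.mem_of_insert_indep (by simpa using hx) ?_)
      rw [← coe_insert]
      exact ofSubmodular_indep_iff.2 ⟨insert_subset (hU hx) hI.1, h⟩)
    exact ⟨T, hT, by exact_mod_cast (hle T).antisymm hcard⟩
  · rintro r ⟨T, -, rfl⟩
    exact_mod_cast hle T

end Matroid

/-! ### Natural-number ranks and Rado's theorem -/

namespace Matroid

open Finset

variable {α ι : Type*}

theorem natCast_toNat_eRk (M : Matroid α) (X : Finset α) :
    ((M.eRk X).toNat : ℕ∞) = M.eRk X :=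
  ENat.natCast_toNat (ne_top_of_le_ne_top (by simp) (M.eRk_le_encard X))

theorem toNat_eRk_le_card (M : Matroid α) (X : Finset α) : (M.eRk X).toNat ≤ #X := by
  have := M.eRk_le_encard X
  rw [← natCast_toNat_eRk, Set.encard_coe_eq_coe_finsetCard] at this
  exact_mod_cast this

theorem toNat_eRk_mono (M : Matroid α) {X Y : Finset α} (h : X ⊆ Y) :
    (M.eRk X).toNat ≤ (M.eRk Y).toNat := by
  have := M.eRk_mono (show (X : Set α) ⊆ Y by exact_mod_cast h)
  rw [← natCast_toNat_eRk M X, ← natCast_toNat_eRk M Y] at this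
  exact_mod_cast this

theorem toNat_eRk_submod [DecidableEq α] (M : Matroid α) (X Y : Finset α) :
    (M.eRk ↑(X ∩ Y)).toNat + (M.eRk ↑(X ∪ Y)).toNat ≤ (M.eRk X).toNat + (M.eRk Y).toNat := by
  have := M.eRk_inter_add_eRk_union_le X Y
  rw [← coe_inter, ← coe_union] at this
  rw [← natCast_toNat_eRk M X, ← natCast_toNat_eRk M Y, ← natCast_toNat_eRk M (X ∩ Y),
    ← natCast_toNat_eRk M (X ∪ Y)] at this
  exact_mod_cast this

theorem indep_of_card_le_toNat_eRk {M : Matroid α} {X : Finset α}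
    (h : #X ≤ (M.eRk X).toNat) : M.Indep X := by
  rw [indep_iff_eRk_eq_encard_of_finite X.finite_toSet, ← natCast_toNat_eRk,
    Set.encard_coe_eq_coe_finsetCard, h.antisymm' (M.toNat_eRk_le_card X)]

theorem Indep.toNat_eRk_eq {M : Matroid α} {X : Finset α} (h : M.Indep X) :
    (M.eRk X).toNat = #X := by
  rw [h.eRk_eq_encard, Set.encard_coe_eq_coe_finsetCard, ENat.toNat_natCast]

variable [DecidableEq α] [Fintype ι] [DecidableEq ι] [Nonempty ι]

/-- A case of Rado's theorem: the subsets `{(x, i) | i ∈ A x}`, for `x ∈ I`, of the ground set of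
the direct sum of the `M i` have an independent transversal if the rank condition holds. -/
theorem exists_partition_of_card_le_sum_eRk_filter (M : ι → Matroid α) (I : Finset α)
    (A : α → Finset ι)
    (h : ∀ J ⊆ I, #J ≤ ∑ i, ((M i).eRk ↑({x ∈ J | i ∈ A x} : Finset α)).toNat) :
    ∃ c : α → ι, ∀ i, (M i).Indep {x | x ∈ I ∧ c x = i} := by
  induction hn : ∑ x ∈ I, #(A x) using Nat.strong_induction_on generalizing A with
  | _ n ih =>
  by_cases hA : ∃ e ∈ I, 1 < #(A e)
  · obtain ⟨e, heI, he⟩ := hA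
    obtain ⟨i₁, hi₁, i₂, hi₂, hne⟩ := one_lt_card.1 he
    -- If neither `i₁` nor `i₂` can be deleted from `A e`, each deletion has a violating set
    -- containing `e`. Uncrossing the two gives the contradiction.
    by_contra hcon
    have key : ∀ k ∈ A e, ∃ J ⊆ I, e ∈ J ∧
        ∑ i, ((M i).eRk ↑({x ∈ J | i ∈ Function.update A e ((A e).erase k) x} : Finset α)).toNat
          < #J := by
      intro k hk
      by_contra! hk'
      refine hcon (ih _ ?_ (Function.update A e ((A e).erase k)) (fun J hJ => ?_) rfl)
      · rw [← hn]
        refine sum_lt_sum (fun x _ => card_le_card ?_) ⟨e, heI, ?_⟩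
        · rcases eq_or_ne x e with rfl | hx
          · simpa using erase_subset _ _
          · simp [hx]
        · simpa using card_erase_lt_of_mem hk
      · by_cases heJ : e ∈ J
        · exact hk' J hJ heJ
        · refine (h J hJ).trans_eq (sum_congr rfl fun i _ => ?_)
          congr 3
          refine filter_congr fun x hx => ?_
          rw [Function.update_of_ne (by rintro rfl; exact heJ hx)]
    obtain ⟨J₁, hJ₁, heJ₁, h₁⟩ := key i₁ hi₁
    obtain ⟨J₂, hJ₂, heJ₂, h₂⟩ := key i₂ hi₂
    have hU := h (J₁ ∪ J₂) (union_subset hJ₁ hJ₂)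
    have hN := h ((J₁ ∩ J₂).erase e) ((erase_subset _ _).trans (inter_subset_left.trans hJ₁))
    rw [card_erase_of_mem (mem_inter.2 ⟨heJ₁, heJ₂⟩)] at hN
    have hcard := card_union_add_card_inter J₁ J₂
    have hpos : 0 < #(J₁ ∩ J₂) := card_pos.2 ⟨e, mem_inter.2 ⟨heJ₁, heJ₂⟩⟩
    -- On the union, `e` loses no index because `i₁ ≠ i₂`; on the intersection, `e` is erased. The
    -- right side is at most `#J₁ + #J₂ - 2`, one less than the left.
    have hle : #(J₁ ∩ J₂) - 1 + #(J₁ ∪ J₂) ≤ ∑ i, (((M i).eRk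
        ↑({x ∈ J₁ | i ∈ Function.update A e ((A e).erase i₁) x} : Finset α)).toNat + ((M i).eRk
        ↑({x ∈ J₂ | i ∈ Function.update A e ((A e).erase i₂) x} : Finset α)).toNat) := by
      refine (add_le_add hN hU).trans ?_
      rw [← sum_add_distrib]
      refine sum_le_sum fun i _ => ?_
      refine le_trans ?_ ((M i).toNat_eRk_submod
        {x ∈ J₁ | i ∈ Function.update A e ((A e).erase i₁) x}
        {x ∈ J₂ | i ∈ Function.update A e ((A e).erase i₂) x})
      refine add_le_add (toNat_eRk_mono _ ?_) (toNat_eRk_mono _ ?_)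
      · intro x hx
        simp only [mem_filter, mem_erase, mem_inter] at hx ⊢
        simp [hx]
      · intro x hx
        simp only [mem_filter, mem_union] at hx ⊢
        rcases eq_or_ne x e with rfl | hxe
        · simp only [Function.update_self, mem_erase]
          grind
        · simpa only [Function.update_of_ne hxe, ← or_and_right] using hx
    rw [sum_add_distrib] at hle
    omega
  · push Not at hA
    have hex : ∀ x ∈ I, ∃ i, A x = {i} := by
      intro x hx
      refine card_eq_one.1 ((hA x hx).antisymm ?_)
      by_contra! h0
      have h1 := h {x} (by simpa using hx)
      have h2 : A x = ∅ := by simpa using h0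
      have h3 : ∀ i, ({y ∈ ({x} : Finset α) | i ∈ A y} : Finset α) = ∅ := by
        intro i
        simp [h2, filter_singleton]
      simp [h3] at h1
    choose! c hc using hex
    refine ⟨c, fun i => ?_⟩
    have hfib : ∀ i, ({x ∈ I | i ∈ A x} : Finset α) = ({x ∈ I | c x = i} : Finset α) :=
      fun i => filter_congr fun x hx => by rw [hc x hx, mem_singleton, eq_comm]
    -- The fibres of `c` have total size at most their total rank, so each rank equals the size of
    -- its fibre.
    have hI := h I Subset.rfl
    simp only [hfib] at hI
    rw [card_eq_sum_card_fiberwise (f := c) (t := univ) (by simp)] at hI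
    have heq := (sum_eq_sum_iff_of_le (fun i _ => (M i).toNat_eRk_le_card {x ∈ I | c x = i})).1
      ((sum_le_sum fun i _ => (M i).toNat_eRk_le_card {x ∈ I | c x = i}).antisymm hI) i (mem_univ i)
    simpa using indep_of_card_le_toNat_eRk heq.ge

end Matroid

/-! ### Linkages as injective predecessor maps -/

namespace Function

variable {α : Type*} {f : α → α} {D I : Set α}

/-- Two orbits that start outside `f '' D` and run inside `D` meet only if they start at the same
point, and then only at the same time. -/
theorem iterate_eq_iterate_of_injOn (hf : Set.InjOn f D) (hI : ∀ v ∈ D, f v ∉ I) {a b : ℕ}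
    {x y : α} (hx : x ∈ I) (hy : y ∈ I) (hxD : ∀ k < a, f^[k] x ∈ D) (hyD : ∀ k < b, f^[k] y ∈ D)
    (h : f^[a] x = f^[b] y) : a = b ∧ x = y := by
  induction a generalizing b with
  | zero =>
    cases b with
    | zero => exact ⟨rfl, h⟩
    | succ b =>
      rw [iterate_succ_apply'] at h
      exact absurd (h ▸ hx) (hI _ (hyD b b.lt_succ_self))
  | succ a ih =>
    cases b with
    | zero =>
      rw [iterate_succ_apply'] at h
      exact absurd (h ▸ hy) (hI _ (hxD a a.lt_succ_self))
    | succ b =>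
      rw [iterate_succ_apply', iterate_succ_apply'] at h
      obtain ⟨h1, h2⟩ := ih (fun k hk => hxD k (hk.trans a.lt_succ_self))
        (fun k hk => hyD k (hk.trans b.lt_succ_self))
        (hf (hxD a a.lt_succ_self) (hyD b b.lt_succ_self) h)
      exact ⟨congrArg Nat.succ h1, h2⟩

/-- An orbit staying in `D` would never repeat, contradicting finiteness. -/
theorem exists_iterate_notMem_of_injOn (hD : D.Finite) (hf : Set.InjOn f D)
    (hI : ∀ v ∈ D, f v ∉ I) {x : α} (hx : x ∈ I) : ∃ n, f^[n] x ∉ D := by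
  by_contra! h
  refine Set.infinite_of_injective_forall_mem (f := fun n => f^[n] x) (fun a b hab => ?_) h hD
  exact (iterate_eq_iterate_of_injOn hf hI hx hx (fun k _ => h k) (fun k _ => h k) hab).1

end Function

namespace DiPath

variable {α : Type*}

theorem sink_mem (P : DiPath α) : P.sink ∈ P.support := List.getLast_mem _

theorem sink_eq_getElem (P : DiPath α) :
    P.sink = P.support[P.support.length - 1]'(Nat.sub_lt (List.length_pos_of_ne_nil P.ne_nil)
      one_pos) :=
  List.getLast_eq_getElem _

theorem source_eq_getElem (P : DiPath α) :
    P.source = P.support[0]'(List.length_pos_of_ne_nil P.ne_nil) :=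
  List.head_eq_getElem _

/-- `v` follows `u` immediately on the path `P`. -/
def Step (P : DiPath α) (u v : α) : Prop :=
  ∃ (i : ℕ) (h : i + 1 < P.support.length), P.support[i] = u ∧ P.support[i + 1] = v

variable {P : DiPath α} {u v w : α}

theorem Step.left_mem (h : P.Step u v) : u ∈ P.support := by
  obtain ⟨i, hi, rfl, -⟩ := h
  exact List.getElem_mem _

theorem Step.right_unique (h : P.Step u v) (h' : P.Step u w) : v = w := by
  obtain ⟨i, hi, hiu, rfl⟩ := h
  obtain ⟨j, hj, hju, rfl⟩ := h'
  obtain rfl := P.nodup.getElem_inj_iff.1 (hiu.trans hju.symm)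
  rfl

theorem Step.ne_sink (h : P.Step u v) : u ≠ P.sink := by
  obtain ⟨i, hi, rfl, -⟩ := h
  rw [sink_eq_getElem, Ne, P.nodup.getElem_inj_iff]
  omega

theorem exists_step (hv : v ∈ P.support) (hne : v ≠ P.source) : ∃ u, P.Step u v := by
  obtain ⟨i, hi, rfl⟩ := List.getElem_of_mem hv
  obtain _ | i := i
  · exact absurd P.source_eq_getElem.symm hne
  · exact ⟨_, i, hi, rfl, rfl⟩

theorem Step.hasEdge {β : Type*} {G : MultiDigraph α β} (h : P.Step u v) (hP : P.IsIn G) :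
    G.HasEdge u v := by
  obtain ⟨i, hi, rfl, rfl⟩ := h
  exact List.isChain_iff_getElem.1 hP.2 i hi

theorem PairwiseDisjoint.eq_of_mem {Ps : Set (DiPath α)} (h : PairwiseDisjoint Ps) {Q : DiPath α}
    (hP : P ∈ Ps) (hQ : Q ∈ Ps) (hvP : v ∈ P.support) (hvQ : v ∈ Q.support) : P = Q := by
  by_contra hne
  exact h P hP Q hQ hne v hvP hvQ

/-- The path `f^[n] x, …, f x, x`. -/
def ofIterate (f : α → α) (x : α) (n : ℕ) (h : Set.InjOn (fun k => f^[k] x) (Set.Iic n)) :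
    DiPath α where
  support := ((List.range (n + 1)).map fun k => f^[k] x).reverse
  ne_nil := by simp
  nodup := by
    rw [List.nodup_reverse]
    refine List.Nodup.map_on (fun a ha b hb hab => h ?_ ?_ hab) List.nodup_range <;>
    · simp only [List.mem_range] at ha hb
      simp only [Set.mem_Iic]
      omega

variable {f : α → α} {x : α} {n : ℕ} {h : Set.InjOn (fun k => f^[k] x) (Set.Iic n)}

theorem mem_support_ofIterate : v ∈ (ofIterate f x n h).support ↔ ∃ k ≤ n, f^[k] x = v := by
  simp [ofIterate, -List.range_map_iterate]

@[simp] theorem sink_ofIterate : (ofIterate f x n h).sink = x := by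
  simp [ofIterate, sink]

@[simp] theorem source_ofIterate : (ofIterate f x n h).source = f^[n] x := by
  simp [ofIterate, source, List.getLast_map, -List.range_map_iterate]

theorem isIn_ofIterate {β : Type*} {G : MultiDigraph α β} (hv : ∀ k ≤ n, f^[k] x ∈ G.verts)
    (he : ∀ k < n, G.HasEdge (f^[k + 1] x) (f^[k] x)) : (ofIterate f x n h).IsIn G := by
  refine ⟨fun v hvs => ?_, ?_⟩
  · obtain ⟨k, hk, rfl⟩ := mem_support_ofIterate.1 hvs
    exact hv k hk
  · rw [ofIterate, List.isChain_reverse, List.isChain_iff_getElem]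
    intro i hi
    simpa [-List.range_map_iterate, -Function.iterate_succ] using he i (by simpa using hi)

end DiPath

/-- A set is linked from `X` iff it avoids the image of an injective map on the remaining vertices
that moves every vertex to itself or to an in-neighbour. -/
theorem exists_isDisjointPaths_iff {α β : Type*} {G : MultiDigraph α β} (hG : G.verts.Finite)
    {X Y I : Set α} (hY : Y ⊆ G.verts) :
    (∃ Ps, IsDisjointPaths G X Y Ps ∧ I = DiPath.sink '' Ps) ↔
      I ⊆ Y ∧ ∃ f : α → α, Set.InjOn f (G.verts \ X) ∧
        ∀ v ∈ G.verts \ X, f v ∉ I ∧ (f v = v ∨ G.HasEdge (f v) v) := by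
  constructor
  · rintro ⟨Ps, ⟨hPs, hdisj⟩, rfl⟩
    refine ⟨by rintro _ ⟨P, hP, rfl⟩; exact (hPs P hP).2.2, ?_⟩
    -- Vertices on a path go to their predecessor, all others to themselves; sinks have no
    -- successor, so they are not hit.
    have hex : ∀ v ∈ G.verts \ X, ∃ u,
        (∃ P ∈ Ps, P.Step u v) ∨ (u = v ∧ ∀ P ∈ Ps, v ∉ P.support) := by
      intro v hv
      by_cases h : ∃ P ∈ Ps, v ∈ P.support
      · obtain ⟨P, hP, hvP⟩ := h
        obtain ⟨u, hu⟩ := P.exists_step hvP (by rintro rfl; exact hv.2 (hPs P hP).2.1)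
        exact ⟨u, .inl ⟨P, hP, hu⟩⟩
      · push Not at h
        exact ⟨v, .inr ⟨rfl, h⟩⟩
    choose! f hf using hex
    refine ⟨f, fun v hv w hw hvw => ?_, fun v hv => ⟨?_, ?_⟩⟩
    · rcases hf v hv with ⟨P, hP, hs⟩ | ⟨h1, h2⟩ <;> rcases hf w hw with ⟨Q, hQ, ht⟩ | ⟨h3, h4⟩
      · rw [hvw] at hs
        obtain rfl := hdisj.eq_of_mem hP hQ hs.left_mem ht.left_mem
        exact hs.right_unique ht
      · exact absurd hs.left_mem (by rw [hvw, h3]; exact h4 P hP)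
      · exact absurd ht.left_mem (by rw [← hvw, h1]; exact h2 Q hQ)
      · exact h1.symm.trans (hvw.trans h3)
    · rintro ⟨Q, hQ, hQv⟩
      rcases hf v hv with ⟨P, hP, hs⟩ | ⟨h1, h2⟩
      · obtain rfl := hdisj.eq_of_mem hP hQ hs.left_mem (hQv ▸ Q.sink_mem)
        exact hs.ne_sink hQv.symm
      · exact h2 Q hQ (h1 ▸ hQv ▸ Q.sink_mem)
    · rcases hf v hv with ⟨P, hP, hs⟩ | ⟨h1, h2⟩
      · exact .inr (hs.hasEdge (hPs P hP).1)
      · exact .inl h1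
  · rintro ⟨hIY, f, hf, hfv⟩
    have hfI : ∀ v ∈ G.verts \ X, f v ∉ I := fun v hv => (hfv v hv).1
    have hfV : ∀ v ∈ G.verts \ X, f v ∈ G.verts := by
      intro v hv
      rcases (hfv v hv).2 with h | ⟨e, he, h, -⟩
      · exact h.symm ▸ hv.1
      · exact h ▸ G.tail_mem e he
    -- Following `f` backwards from `x`, the first vertex outside `G.verts \ X` lies in `X` and
    -- becomes the source.
    have hex : ∀ x ∈ I, ∃ n, f^[n] x ∉ G.verts \ X ∧ ∀ k < n, f^[k] x ∈ G.verts \ X := by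
      classical
      intro x hx
      have h := Function.exists_iterate_notMem_of_injOn hG.sdiff hf hfI hx
      exact ⟨Nat.find h, Nat.find_spec h, fun k hk => not_not.1 (Nat.find_min h hk)⟩
    choose! n hn hlt using hex
    have hverts : ∀ x ∈ I, ∀ k ≤ n x, f^[k] x ∈ G.verts := by
      intro x hx k hk
      cases k with
      | zero => exact hY (hIY hx)
      | succ k =>
        rw [Function.iterate_succ_apply']
        exact hfV _ (hlt x hx k hk)
    have hmeet : ∀ x ∈ I, ∀ y ∈ I, ∀ a ≤ n x, ∀ b ≤ n y, f^[a] x = f^[b] y → a = b ∧ x = y :=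
      fun x hx y hy a ha b hb => Function.iterate_eq_iterate_of_injOn hf hfI hx hy
        (fun k hk => hlt x hx k (hk.trans_le ha)) (fun k hk => hlt y hy k (hk.trans_le hb))
    have hinj : ∀ x ∈ I, Set.InjOn (fun k => f^[k] x) (Set.Iic (n x)) :=
      fun x hx a ha b hb hab => (hmeet x hx x hx a ha b hb hab).1
    refine ⟨Set.range fun x : I => DiPath.ofIterate f x (n x) (hinj x x.2), ⟨?_, ?_⟩, ?_⟩
    · rintro _ ⟨⟨x, hx⟩, rfl⟩
      refine ⟨DiPath.isIn_ofIterate (hverts x hx) fun k hk => ?_, ?_, ?_⟩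
      · have hkD := hlt x hx k hk
        rw [Function.iterate_succ_apply']
        -- A fixed point would make the orbit take the same value at two times.
        refine (hfv _ hkD).2.resolve_left fun h => ?_
        rw [← Function.iterate_succ_apply' f k x] at h
        have := (hmeet x hx x hx (k + 1) hk k hk.le h).1
        omega
      · rw [DiPath.source_ofIterate]
        by_contra h
        exact hn x hx ⟨hverts x hx _ le_rfl, h⟩
      · rw [DiPath.sink_ofIterate]
        exact hIY hx
    · rintro _ ⟨⟨x, hx⟩, rfl⟩ _ ⟨⟨y, hy⟩, rfl⟩ hne v hvx hvy
      obtain ⟨a, ha, rfl⟩ := DiPath.mem_support_ofIterate.1 hvx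
      obtain ⟨b, hb, hab⟩ := DiPath.mem_support_ofIterate.1 hvy
      obtain rfl := (hmeet x hx y hy a ha b hb hab.symm).2
      exact hne rfl
    · ext x
      simp

/-! ### Transversal matroids and gammoids -/

namespace Matroid

open Finset

variable {α : Type*} [DecidableEq α]

/-- The matroid on `E` whose independent sets are those that can be matched into the sets `N x`. -/
def transversal (E : Finset α) (N : α → Finset α) : Matroid α :=
  ofSubmodular E (fun J => #(J.biUnion N)) (by simp)
    (fun _ _ h => card_le_card (biUnion_subset_biUnion_of_subset_left N h)) (fun X Y => by
      have h : (X ∩ Y).biUnion N ⊆ X.biUnion N ∩ Y.biUnion N :=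
        subset_inter (biUnion_subset_biUnion_of_subset_left N inter_subset_left)
          (biUnion_subset_biUnion_of_subset_left N inter_subset_right)
      rw [union_biUnion, ← card_inter_add_card_union (X.biUnion N)]
      exact Nat.add_le_add_right (card_le_card h) _)

variable {E D : Finset α} {N : α → Finset α} {f : α → α}

@[simp] theorem transversal_ground : (transversal E N).E = E := rfl

theorem transversal_indep_iff {I : Finset α} :
    (transversal E N).Indep I ↔ I ⊆ E ∧ ∀ J ⊆ I, #J ≤ #(J.biUnion N) :=
  ofSubmodular_indep_iff

/-- No independent set exceeds `#D`, because all neighbours lie in `D`; the image is matched back to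
`D` and has that size. -/
theorem isBase_transversal_image (hN : ∀ x, N x ⊆ D) (hf : Set.InjOn f D)
    (hfE : ∀ v ∈ D, f v ∈ E) (hfN : ∀ v ∈ D, v ∈ N (f v)) :
    (transversal E N).IsBase ↑(D.image f) := by
  have hind : (transversal E N).Indep ↑(D.image f) := by
    refine transversal_indep_iff.2 ⟨image_subset_iff.2 hfE, fun J hJ => ?_⟩
    have h1 : J ⊆ ({v ∈ D | f v ∈ J} : Finset α).image f := by
      intro x hx
      obtain ⟨v, hv, rfl⟩ := mem_image.1 (hJ hx)
      exact mem_image_of_mem f (mem_filter.2 ⟨hv, hx⟩)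
    have h2 : ({v ∈ D | f v ∈ J} : Finset α) ⊆ J.biUnion N := by
      intro v hv
      rw [mem_filter] at hv
      exact mem_biUnion.2 ⟨f v, hv.2, hfN v hv.1⟩
    exact (card_le_card h1).trans (card_image_le.trans (card_le_card h2))
  refine hind.isBase_of_maximal fun J hJ hsub => ?_
  obtain ⟨J, rfl⟩ := (E.finite_toSet.subset hJ.subset_ground).exists_finset_coe
  rw [coe_subset] at hsub
  refine congrArg _ (eq_of_subset_of_card_le hsub ?_)
  rw [card_image_of_injOn hf]
  exact ((transversal_indep_iff.1 hJ).2 J Subset.rfl).trans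
    (card_le_card (biUnion_subset.2 fun x _ => hN x))

/-- `D` itself is a base, so `#W = #D`. A Hall matching of `W` into `D` is then bijective, and `f`
is its inverse. -/
theorem exists_injOn_of_isBase_transversal (hN : ∀ x, N x ⊆ D) (hDE : D ⊆ E)
    (hD : ∀ v ∈ D, v ∈ N v) {W : Set α} (hW : (transversal E N).IsBase W) :
    ∃ f : α → α, Set.InjOn f D ∧ ∀ v ∈ D, f v ∈ W ∧ v ∈ N (f v) := by
  obtain ⟨W, rfl⟩ := (E.finite_toSet.subset hW.subset_ground).exists_finset_coe
  have hcard := hW.encard_eq_encard_of_isBase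
    (isBase_transversal_image (f := id) hN Function.injective_id.injOn hDE hD)
  rw [image_id, Set.encard_coe_eq_coe_finsetCard, Set.encard_coe_eq_coe_finsetCard,
    Nat.cast_inj] at hcard
  obtain ⟨g, hg, hgN⟩ := (all_card_le_biUnion_card_iff_exists_injective fun x : W => N x).1 (by
    intro s
    have h := (transversal_indep_iff.1 hW.indep).2 (s.image (↑)) (by
      intro x hx
      obtain ⟨y, -, rfl⟩ := mem_image.1 hx
      exact y.2)
    rwa [card_image_of_injective _ Subtype.coe_injective, image_biUnion] at h)
  have himage : univ.image g = D := by
    refine eq_of_subset_of_card_le (image_subset_iff.2 fun x _ => hN x (hgN x)) ?_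
    rw [card_image_of_injective _ hg, card_univ, Fintype.card_coe, hcard]
  have hsurj : ∀ v ∈ D, ∃ w, ∃ h : w ∈ W, g ⟨w, h⟩ = v := by
    intro v hv
    rw [← himage, mem_image] at hv
    obtain ⟨w, -, rfl⟩ := hv
    exact ⟨w, w.2, rfl⟩
  choose! f hfW hgf using hsurj
  refine ⟨f, fun v hv w hw h => ?_, fun v hv => ⟨hfW v hv, ?_⟩⟩
  · rw [← hgf v hv, ← hgf w hw]
    simp only [h]
  · have := hgN ⟨f v, hfW v hv⟩
    rwa [hgf v hv] at this

end Matroid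

/-- Gammoids are matroids: they are restrictions of duals of transversal matroids. -/
theorem exists_isGammoid {α β : Type*} {G : MultiDigraph α β} (hG : G.verts.Finite)
    {X Y : Set α} (hY : Y ⊆ G.verts) : ∃ M : Matroid α, IsGammoid M G X Y := by
  classical
  let D : Finset α := (hG.sdiff (t := X)).toFinset
  -- `v ∈ N u` says that `u` is an allowed value of a predecessor map at `v`.
  let N : α → Finset α := fun u => {v ∈ D | u = v ∨ G.HasEdge u v}
  have hDmem : ∀ v, v ∈ D ↔ v ∈ G.verts \ X := fun v => Set.Finite.mem_toFinset _
  have hN : ∀ x, N x ⊆ D := fun x => Finset.filter_subset _ _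
  refine ⟨(Matroid.transversal hG.toFinset N).dual.restrict Y, rfl, fun I => ?_⟩
  rw [exists_isDisjointPaths_iff hG hY, Matroid.restrict_indep_iff, and_comm,
    Matroid.dual_indep_iff_exists']
  refine and_congr_right fun hIY => ⟨?_, ?_⟩
  · rintro ⟨-, W, hW, hdisj⟩
    obtain ⟨f, hf, hfW⟩ := Matroid.exists_injOn_of_isBase_transversal hN
      (fun v hv => hG.mem_toFinset.2 ((hDmem v).1 hv).1)
      (fun v hv => Finset.mem_filter.2 ⟨hv, .inl rfl⟩) hW
    refine ⟨f, by simpa [D] using hf, fun v hv => ?_⟩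
    have h := hfW v ((hDmem v).2 hv)
    exact ⟨fun hI => hdisj.notMem_of_mem_left hI h.1, (Finset.mem_filter.1 h.2).2⟩
  · rintro ⟨f, hf, hfv⟩
    refine ⟨by simpa using hIY.trans hY, _,
      Matroid.isBase_transversal_image (D := D) (f := f) hN (by simpa [D] using hf) ?_ ?_, ?_⟩
    · intro v hv
      rw [hDmem] at hv
      rw [Set.Finite.mem_toFinset]
      rcases (hfv v hv).2 with h | ⟨e, he, h, -⟩
      · exact h.symm ▸ hv.1
      · exact h ▸ G.tail_mem e he
    · exact fun v hv => Finset.mem_filter.2 ⟨hv, (hfv v ((hDmem v).1 hv)).2⟩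
    · rw [Set.disjoint_right]
      intro x hx
      obtain ⟨v, hv, rfl⟩ := Finset.mem_image.1 (Finset.mem_coe.1 hx)
      exact (hfv v ((hDmem v).1 hv)).1

/-! ### Matroid union -/

namespace Matroid

open Finset

variable {α ι : Type*} [DecidableEq α] [Fintype ι]

/-- The union of the matroids `M i`, on the ground set `E`. -/
noncomputable def unionOn (E : Finset α) (M : ι → Matroid α) : Matroid α :=
  ofSubmodular E (fun J => ∑ i, ((M i).eRk J).toNat) (by simp)
    (fun _ _ h => sum_le_sum fun i _ => (M i).toNat_eRk_mono h) (fun X Y => by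
      rw [← sum_add_distrib, ← sum_add_distrib]
      exact sum_le_sum fun i _ => (M i).toNat_eRk_submod X Y)

variable {E : Finset α} {M : ι → Matroid α}

@[simp] theorem unionOn_ground : (unionOn E M).E = E := rfl

/-- A colouring comes from Rado's theorem with every index allowed; conversely, the colour classes
of `J` have size at most the ranks of `J`. -/
theorem unionOn_indep_iff [Nonempty ι] {I : Set α} :
    (unionOn E M).Indep I ↔
      I ⊆ E ∧ ∃ c : α → ι, ∀ i, (M i).Indep {x | x ∈ I ∧ c x = i} := by
  classical
  by_cases hIE : I ⊆ E
  swap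
  · exact iff_of_false (fun h => hIE h.subset_ground) (fun h => hIE h.1)
  obtain ⟨I, rfl⟩ := (E.finite_toSet.subset hIE).exists_finset_coe
  refine ofSubmodular_indep_iff.trans ?_
  rw [coe_subset]
  refine and_congr_right fun _ => ⟨fun h => ?_, ?_⟩
  · exact exists_partition_of_card_le_sum_eRk_filter M I (fun _ => univ) (by simpa using h)
  · rintro ⟨c, hc⟩ J hJ
    rw [card_eq_sum_card_fiberwise (f := c) (t := univ) (by simp)]
    refine sum_le_sum fun i _ => ?_
    have hi : (M i).Indep ↑({x ∈ J | c x = i} : Finset α) :=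
      (hc i).subset fun x hx => by
        have hx := mem_filter.1 (mem_coe.1 hx)
        exact ⟨hJ hx.1, hx.2⟩
    exact hi.toNat_eRk_eq.ge.trans ((M i).toNat_eRk_mono (filter_subset _ _))

theorem isLeast_eRk_unionOn {U : Set α} (hU : U ⊆ E) :
    IsLeast {r : ℕ∞ | ∃ T ⊆ U, r = (U \ T).encard + ∑ i, (M i).eRk T}
      ((unionOn E M).eRk U) := by
  obtain ⟨U, rfl⟩ := (E.finite_toSet.subset hU).exists_finset_coe
  refine Eq.subst (motive := fun s => IsLeast s _) ?_ (isLeast_eRk_ofSubmodular (coe_subset.1 hU))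
  ext r
  have hr : ∀ T : Finset α, ((#(U \ T) + ∑ i, ((M i).eRk T).toNat : ℕ) : ℕ∞) =
      ((U : Set α) \ T).encard + ∑ i, (M i).eRk T := fun T => by
    rw [← coe_sdiff, Set.encard_coe_eq_coe_finsetCard, Nat.cast_add, Nat.cast_sum]
    simp only [natCast_toNat_eRk]
  constructor
  · rintro ⟨T, hT, rfl⟩
    exact ⟨T, coe_subset.2 hT, hr T⟩
  · rintro ⟨T, hT, rfl⟩
    obtain ⟨T, rfl⟩ := (U.finite_toSet.subset hT).exists_finset_coe
    exact ⟨T, coe_subset.1 hT, (hr T).symm⟩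

end Matroid

/-! ### D-paths as a union of gammoids -/

/-- The colour of a sink names a part with a path ending there. Conversely, paths linked to
different colour classes have different sinks, so the parts are disjoint. -/
theorem exists_isDPaths_iff {α β : Type*} {ℓ : ℕ} {G : Fin ℓ → MultiDigraph α β}
    {S : Fin ℓ → Set α} {B : Set α} {M : Fin ℓ → Matroid α}
    (hM : ∀ i, IsGammoid (M i) (G i) (S i) (B ∩ (G i).verts)) [NeZero ℓ] {I : Set α} :
    (∃ Ps : Set (DiPath α), IsDPaths G S B Ps ∧ I = DiPath.sink '' Ps) ↔
      I ⊆ B ∧ ∃ c : α → Fin ℓ, ∀ i, (M i).Indep {x | x ∈ I ∧ c x = i} := by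
  constructor
  · rintro ⟨_, ⟨⟨part, rfl, -, hin, hsrc⟩, hsink, hB⟩, rfl⟩
    refine ⟨by rintro _ ⟨P, hP, rfl⟩; exact hB P hP, ?_⟩
    have hex : ∀ x ∈ DiPath.sink '' ⋃ i, part i, ∃ i, ∃ P ∈ part i, P.sink = x := by
      rintro _ ⟨P, hP, rfl⟩
      obtain ⟨i, hi⟩ := Set.mem_iUnion.1 hP
      exact ⟨i, P, hi, rfl⟩
    choose! c hc using hex
    refine ⟨c, fun i => ?_⟩
    have hi : (M i).Indep (DiPath.sink '' part i) := by
      refine ((hM i).2 _).2 ⟨part i, ⟨fun P hP => ?_, (hin i).2⟩, rfl⟩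
      have hPi := (hin i).1 P hP
      exact ⟨hPi, hsrc i P hP, hB P (Set.mem_iUnion_of_mem i hP), hPi.1 _ P.sink_mem⟩
    refine hi.subset ?_
    rintro x ⟨hx, rfl⟩
    exact hc x hx
  · rintro ⟨hIB, c, hc⟩
    choose part hpart himage using fun i => ((hM i).2 _).1 (hc i)
    have hmem : ∀ i, ∀ P ∈ part i, P.sink ∈ I ∧ c P.sink = i := fun i P hP =>
      (himage i).ge ⟨P, hP, rfl⟩
    refine ⟨⋃ i, part i, ⟨⟨part, rfl, fun i j hij => ?_, fun i => ⟨?_, (hpart i).2⟩, ?_⟩,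
      ?_, ?_⟩, ?_⟩
    · exact Set.disjoint_left.2 fun P hi hj =>
        hij ((hmem i P hi).2.symm.trans (hmem j P hj).2)
    · exact fun P hP => ((hpart i).1 P hP).1
    · exact fun i P hP => ((hpart i).1 P hP).2.1
    · simp only [Set.mem_iUnion]
      rintro P ⟨i, hP⟩ Q ⟨j, hQ⟩ hne heq
      obtain rfl : i = j := (hmem i P hP).2.symm.trans (heq ▸ (hmem j Q hQ).2)
      exact (hpart i).2 P hP Q hQ hne _ P.sink_mem (heq ▸ Q.sink_mem)
    · simp only [Set.mem_iUnion]
      rintro P ⟨i, hP⟩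
      exact hIB (hmem i P hP).1
    · rw [Set.image_iUnion]
      ext x
      simp [← himage]

theorem mainTheorem7 {α β : Type*} (ℓ : ℕ) (hℓ : 1 ≤ ℓ)
    (G : Fin ℓ → MultiDigraph α β) (hG : ∀ i, (G i).verts.Finite)
    (S : Fin ℓ → Set α) (hS : ∀ i, S i ⊆ (G i).verts)
    (B : Set α) (hB : B ⊆ ⋃ i, (G i).verts) :
    ∃ M : Fin ℓ → Matroid α,
      (∀ i, IsGammoid (M i) (G i) (S i) (B ∩ (G i).verts)) ∧
      ∃ N : Matroid α,
        N.E = B ∧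
        (∀ I : Set α, N.Indep I ↔
          ∃ Ps : Set (DiPath α), IsDPaths G S B Ps ∧ I = DiPath.sink '' Ps) ∧
        ∀ U ⊆ B,
          IsLeast {r : ℕ∞ | ∃ T ⊆ U,
              r = (U \ T).encard + ∑ i, (M i).eRk (T ∩ (G i).verts)}
            (N.eRk U) := by
  classical
  have : NeZero ℓ := ⟨by omega⟩
  choose M hM using fun i => exists_isGammoid (X := S i) (hG i)
    (Set.inter_subset_right : B ∩ (G i).verts ⊆ (G i).verts)
  have hBfin : B.Finite := (Set.finite_iUnion hG).subset hB
  refine ⟨M, hM, Matroid.unionOn hBfin.toFinset M, by simp, fun I => ?_, fun U hU => ?_⟩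
  · rw [exists_isDPaths_iff hM, Matroid.unionOn_indep_iff, Set.Finite.coe_toFinset]
  -- Elements outside the ground set of `M i` do not affect its rank, and within `B` these are the
  -- elements outside `(G i).verts`.
  · have hrk : ∀ T ⊆ U, ∀ i, (M i).eRk (T ∩ (G i).verts) = (M i).eRk T := by
      intro T hT i
      rw [← Matroid.eRk_inter_ground, ← Matroid.eRk_inter_ground _ T, (hM i).1]
      congr 1
      ext x
      have := @hT x
      simp
      tauto
    convert Matroid.isLeast_eRk_unionOn (M := M) (E := hBfin.toFinset) (by simpa using hU) using 1
    ext r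
    refine exists_congr fun T => and_congr_right fun hT => ?_
    simp only [hrk T hT]
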